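/- Let $q$ be a prime power, $a\in\mathbb{F}_q$ and let $s$ be an integer with $1<s<q$. For $n\ge 0$ let $u(n)\in\mathbb{F}_q$ be the coefficient of $T^{-n}$ in the series $\frac{\alpha}{\Pi}L(1,\chi_s)\in\mathbb{F}_q[[1/T]]$ given by $$\frac{\alpha}{\Pi}L(1,\chi_s)=\sum_{k=0}^{\infty}(-1)^{k(s-1)}\left(\frac1T\right)^{(q-s)\frac{q^k-1}{q-1}}\left(1-\frac aT\right)^{s\frac{q^k-1}{q-1}}\prod_{j=k+1}^{\infty}\left(1-\left(\frac1T\right)^{q^j-1}\right).$$ For $n,j\ge 0$ let $[1^n0^j]_q=q^j\frac{q^n-1}{q-1}$ be the integer whose base-$q$ expansion consists of $n$ digits $1$ followed by $j$ digits $0$, and let $v_j$ be the sequence $v_j(n)=u([1^n0^j]_q)$, $n\ge 0$. Then: 1. for every $j\ge 0$ the sequence $v_j$ is ultimately periodic; let $P_j$ be the length of its initial non-periodic segment, that is, the least $N\ge 0$ such that $(v_j(n))_{n\ge N}$ is periodic; 2. $P_j$ is strictly increasing in $j\ge 1$, that is, $P_i<P_j$ whenever $1\le i<j$; 3. $P_j\ge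 q^{j-1}$ for every $j\ge 3$; 4. in particular, the set of sequences $\{v_j : j\ge 0\}$ is infinite. -/

import Mathlib

open scoped PowerSeries.WithPiTopology

/-- The product `∏_{j ≥ k+1} (1 - X^(q^j - 1))` in `F⟦X⟧`, where `X = 1/T`, `q = #F` and `F`
carries the discrete topology (so convergence is `X`-adic). -/
noncomputable def tailProd (F : Type*) [Field F] [Fintype F] (k : ℕ) : PowerSeries F :=
  letI : TopologicalSpace F := ⊥
  ∏' i : ℕ, (1 - (PowerSeries.X : PowerSeries F) ^ (Fintype.card F ^ (k + 1 + i) - 1))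

/-- The `k`-th summand
`(-1)^(k(s-1)) X^((q-s)(q^k-1)/(q-1)) (1-aX)^(s(q^k-1)/(q-1)) ∏_{j ≥ k+1} (1 - X^(q^j - 1))`
with `X = 1/T`. -/
noncomputable def summand {F : Type*} [Field F] [Fintype F] (s : ℕ) (a : F) (k : ℕ) :
    PowerSeries F :=
  (-1) ^ (k * (s - 1))
    * PowerSeries.X ^ ((Fintype.card F - s) * ((Fintype.card F ^ k - 1) / (Fintype.card F - 1)))
    * (1 - PowerSeries.C a * PowerSeries.X) ^
        (s * ((Fintype.card F ^ k - 1) / (Fintype.card F - 1)))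
    * tailProd F k

/-- The series `(α/Π) L(1, χ_s)`, as a power series in `X = 1/T` over `F`. -/
noncomputable def alphaPiL {F : Type*} [Field F] [Fintype F] (s : ℕ) (a : F) : PowerSeries F :=
  letI : TopologicalSpace F := ⊥
  ∑' k : ℕ, summand s a k

/-- `u(n)`, the coefficient of `T^(-n)` in `(α/Π) L(1, χ_s)`. -/
noncomputable def uCoeff {F : Type*} [Field F] [Fintype F] (s : ℕ) (a : F) (n : ℕ) : F :=
  PowerSeries.coeff n (alphaPiL s a)

/-- The integer `[1^n 0^j]_q`, whose base-`q` expansion is `n` ones followed by `j` zeros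
(`Nat.ofDigits` takes the least significant digit first). -/
def onesZeros (q n j : ℕ) : ℕ :=
  Nat.ofDigits q (List.replicate j 0 ++ List.replicate n 1)

/-- The sequence `n ↦ u([1^n 0^j]_q)`, `n ≥ 0`. -/
noncomputable def uSeq {F : Type*} [Field F] [Fintype F] (s : ℕ) (a : F) (j : ℕ) : ℕ → F :=
  fun n => uCoeff s a (onesZeros (Fintype.card F) n j)

/-- `(v n)_{n ≥ N}` is periodic. -/
def PeriodicFrom {A : Type*} (v : ℕ → A) (N : ℕ) : Prop :=
  ∃ p : ℕ, 0 < p ∧ ∀ n, N ≤ n → v (n + p) = v n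

/-- `v` is ultimately periodic. -/
def UltimatelyPeriodic {A : Type*} (v : ℕ → A) : Prop :=
  ∃ N : ℕ, PeriodicFrom v N

/-- The length of the initial non-periodic segment of an ultimately periodic sequence: the least
`N` such that `(v n)_{n ≥ N}` is periodic. -/
noncomputable def preperiod {A : Type*} (v : ℕ → A) : ℕ :=
  sInf {N : ℕ | PeriodicFrom v N}

/-- The products defining `tailProd` converge. -/
theorem multipliable_tailProd (F : Type*) [Field F] [Fintype F] (k : ℕ) :
    letI : TopologicalSpace F := ⊥
    Multipliable fun i : ℕ =>
      (1 - (PowerSeries.X : PowerSeries F) ^ (Fintype.card F ^ (k + 1 + i) - 1)) := by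
  let _ : TopologicalSpace F := ⊥
  have _ : DiscreteTopology F := ⟨rfl⟩
  simp_rw [sub_eq_add_neg]
  apply PowerSeries.WithPiTopology.multipliable_one_add_of_tendsto_order_atTop_nhds_top
  refine ENat.tendsto_nhds_top_iff_natCast_lt.mpr
    (fun n => Filter.eventually_atTop.mpr ⟨n, fun m hm => ?_⟩)
  rw [PowerSeries.order_neg, PowerSeries.order_X_pow]
  have hq : 1 < Fintype.card F := Fintype.one_lt_card
  have h : k + 1 + m < Fintype.card F ^ (k + 1 + m) := Nat.lt_pow_self hq
  norm_cast
  omega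

/-- The series defining `alphaPiL` converges. -/
theorem summable_summand {F : Type*} [Field F] [Fintype F] (s : ℕ) (hs : s < Fintype.card F)
    (a : F) :
    letI : TopologicalSpace F := ⊥
    Summable (summand s a) := by
  let _ : TopologicalSpace F := ⊥
  have _ : DiscreteTopology F := ⟨rfl⟩
  apply PowerSeries.WithPiTopology.summable_of_tendsto_order_atTop_nhds_top
  refine ENat.tendsto_nhds_top_iff_natCast_lt.mpr
    (fun n => Filter.eventually_atTop.mpr ⟨n + 2, fun k hk => ?_⟩)
  have hq : 1 < Fintype.card F := Fintype.one_lt_card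
  set e := (Fintype.card F - s) * ((Fintype.card F ^ k - 1) / (Fintype.card F - 1)) with he
  have hlt : n < e := by
    have h1 : k ≤ (Fintype.card F ^ k - 1) / (Fintype.card F - 1) := by
      rw [← Nat.geomSum_eq hq]
      calc k = ∑ _i ∈ Finset.range k, 1 := by simp
        _ ≤ _ := Finset.sum_le_sum fun i _ => Nat.one_le_pow _ _ (by omega)
    have h2 : 1 ≤ Fintype.card F - s := by omega
    calc n < k := by omega
      _ ≤ (Fintype.card F ^ k - 1) / (Fintype.card F - 1) := h1
      _ ≤ e := Nat.le_mul_of_pos_left _ h2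
  have hdvd : (PowerSeries.X : PowerSeries F) ^ e ∣ summand s a k :=
    Dvd.intro_left _ rfl |>.mul_right _ |>.mul_right _
  have hle : (e : ℕ∞) ≤ (summand s a k).order :=
    PowerSeries.nat_le_order _ _ (PowerSeries.X_pow_dvd_iff.mp hdvd)
  exact lt_of_lt_of_le (by exact_mod_cast hlt) hle

/-!
Write `q = #F`, `X = 1/T` and `e_k = (q^k - 1)/(q - 1)`; then `[1^n 0^j]_q = q^j e_n`, which is
less than `e_{n+j}` when `j ≥ 1`. Since `x^q = x` on `F`, the `k`-th summand of the series is
`G^(e_k)` times its infinite product, where `G = (-1)^(s-1) X^(q-s) (1-aX)^s` (`baseFactor`).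
Truncating the products gives polynomials `L_k` (`partialSum`) with `L_0 = 0` and
`L_{k+1} = L_k (1 - X^(q^k-1)) + G^(e_k)`, and `u(N)` is the coefficient of `X^N` in `L_k` as soon
as `N < e_k` (`uCoeff_eq`).

Put `b = a^s`, so that `G` has degree at most `q` and coefficient `-b` at `X^q`. As `deg L_k < e_k`
and `G^(e_{k+1}) = G^(e_k) G(X^(q^k))`, comparing coefficients in the recursion of `L` shows that
`v = v_j`, `j ≥ 1`, solves a first-order linear recurrence (`uSeq_recurrence`)
`v(n+1) + b v(n) = (-1)^n [X^(q^j+n)] H_j`, with `H_j = G^(e_j) - X^(q^j-1) (1-bX) L_j`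
(`recurrencePoly`).
The right-hand side has finite support and `-b` is zero or a root of unity. Hence `v` is
ultimately periodic, with preperiod `deg H_j - q^j + 1` if `deg H_j ≥ q^j`, increased by one when
`a = 0` (`preperiod_of_recurrence`).

It remains to compute `deg H_j`. With `h = H_1 = G - X^(q-1) (1-bX)` (`defect`), whose degree lies
between `1` and `q - 1`, the main terms cancel and leave (`recurrencePoly_succ`)
`H_{j+1} = H_j X^(q^j(q-1)) (1 - X^(q^j-1)) + G^(e_j) h(X^(q^j))`.
The first term dominates for every `j ≥ 1`, so `deg H_{j+1} = deg H_j + q^(j+1) - 1`. Therefore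
`P_{j+1} = P_j + q^j - 1` for `j ≥ 2`, while `deg H_1 < q` makes `P_1` smaller than `P_2`.
The sequence `v_0` is `n ↦ c^n` for `n ≥ 1`, with `c` the coefficient of `X` in `G`.
-/

open Polynomial

/-! ### Repunits -/

/-- The repunit `1 + q + ⋯ + q^(k-1)`, that is `(q^k - 1)/(q - 1)`. -/
def repunit (q k : ℕ) : ℕ := ∑ i ∈ Finset.range k, q ^ i

@[simp] lemma repunit_zero (q : ℕ) : repunit q 0 = 0 := rfl

lemma repunit_succ (q k : ℕ) : repunit q (k + 1) = repunit q k + q ^ k :=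
  Finset.sum_range_succ _ _

lemma repunit_succ' (q k : ℕ) : repunit q (k + 1) = q * repunit q k + 1 := by
  induction k with
  | zero => simp [repunit]
  | succ k ih =>
    conv_lhs => rw [repunit_succ, ih]
    conv_rhs => rw [repunit_succ]
    ring

lemma repunit_add (q n j : ℕ) : repunit q (n + j) = repunit q j + q ^ j * repunit q n := by
  induction n with
  | zero => simp
  | succ n ih =>
    rw [Nat.add_right_comm, repunit_succ, ih, repunit_succ, pow_add]; ring

lemma two_mul_repunit_lt {q : ℕ} (hq : 3 ≤ q) (k : ℕ) : 2 * repunit q k < q ^ k := by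
  induction k with
  | zero => simp
  | succ k ih => rw [repunit_succ, pow_succ]; nlinarith

lemma le_repunit {q : ℕ} (hq : 1 ≤ q) (k : ℕ) : k ≤ repunit q k := by
  induction k with
  | zero => simp
  | succ k ih => rw [repunit_succ]; have := Nat.one_le_pow k q hq; omega

lemma onesZeros_eq (q n j : ℕ) : onesZeros q n j = q ^ j * repunit q n := by
  have h : Nat.ofDigits q (List.replicate n 1) = repunit q n := by
    induction n with
    | zero => simp
    | succ n ih => rw [List.replicate_succ, Nat.ofDigits_cons, ih, repunit_succ']; simp [add_comm]
  simp [onesZeros, Nat.ofDigits_append, Nat.ofDigits_replicate_zero, h]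

/-! ### The polynomials behind the series -/

section Polynomials

lemma natDegree_one_sub_le {F : Type*} [Field F] (c : F) : (1 - C c * X).natDegree ≤ 1 := by
  compute_degree

lemma coeff_one_sub_pow {F : Type*} [Field F] (c : F) (n : ℕ) :
    ((1 - C c * X) ^ n).coeff n = (-c) ^ n := by
  have := coeff_pow_of_natDegree_le (m := n) (natDegree_one_sub_le c)
  simpa [coeff_one] using this

variable {F : Type*} [Field F] [Fintype F] (s : ℕ) (a : F)

/-- The factor `(-1)^(s-1) X^(q-s) (1-aX)^s`. The `k`-th summand of the series without its
infinite product is the power of this polynomial with exponent `repunit q k`. -/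
noncomputable def baseFactor : F[X] :=
  C ((-1) ^ (s - 1)) * X ^ (Fintype.card F - s) * (1 - C a * X) ^ s

/-- The difference between `baseFactor` and the binomial `X^(q-1) (1-a^s X)`, which has the same
coefficient of `X^q`. -/
noncomputable def defect : F[X] :=
  baseFactor s a - X ^ (Fintype.card F - 1) * (1 - C (a ^ s) * X)

/-- The first `k` summands of the series, with the products truncated to the indices below `k`:
`∑_{i<k} baseFactor^(repunit q i) ∏_{i<l<k} (1 - X^(q^l-1))`. -/
noncomputable def partialSum : ℕ → F[X]
  | 0 => 0
  | k + 1 => partialSum k * (1 - X ^ (Fintype.card F ^ k - 1))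
      + baseFactor s a ^ repunit (Fintype.card F) k

/-- The polynomial whose coefficients in degree at least `q^j` govern the first-order linear
recurrence satisfied by `uSeq s a j`. -/
noncomputable def recurrencePoly (j : ℕ) : F[X] :=
  baseFactor s a ^ repunit (Fintype.card F) j
    - X ^ (Fintype.card F ^ j - 1) * (1 - C (a ^ s) * X) * partialSum s a j

lemma expand_card_pow (k : ℕ) (f : F[X]) :
    expand F (Fintype.card F ^ k) f = f ^ Fintype.card F ^ k := by
  induction k with
  | zero => simp
  | succ k ih => rw [pow_succ', expand_mul, ih, map_pow, FiniteField.expand_card, ← pow_mul]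

lemma baseFactor_pow_repunit_succ (k : ℕ) :
    baseFactor s a ^ repunit (Fintype.card F) (k + 1) =
      baseFactor s a ^ repunit (Fintype.card F) k
        * expand F (Fintype.card F ^ k) (baseFactor s a) := by
  rw [repunit_succ, pow_add, expand_card_pow]

lemma baseFactor_eq :
    baseFactor s a = X ^ (Fintype.card F - 1) * (1 - C (a ^ s) * X) + defect s a := by
  rw [defect]; ring

variable {s}

lemma natDegree_baseFactor_le (hsq : s < Fintype.card F) :
    (baseFactor s a).natDegree ≤ Fintype.card F := by
  have h1 : ((1 - C a * X) ^ s).natDegree ≤ s * 1 :=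
    natDegree_pow_le_of_le s (natDegree_one_sub_le a)
  have h2 : (C ((-1 : F) ^ (s - 1)) * X ^ (Fintype.card F - s)).natDegree ≤ Fintype.card F - s :=
    natDegree_C_mul_X_pow_le _ _
  exact (natDegree_mul_le_of_le h2 h1).trans (by omega)

lemma natDegree_baseFactor_pow_le (hsq : s < Fintype.card F) (k : ℕ) :
    (baseFactor s a ^ repunit (Fintype.card F) k).natDegree ≤
      Fintype.card F * repunit (Fintype.card F) k :=
  (natDegree_pow_le_of_le _ (natDegree_baseFactor_le a hsq)).trans (by rw [mul_comm])

lemma coeff_baseFactor_card (hs1 : 1 < s) (hsq : s < Fintype.card F) :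
    (baseFactor s a).coeff (Fintype.card F) = -a ^ s := by
  obtain ⟨s, rfl⟩ : ∃ r, s = r + 1 := ⟨s - 1, by omega⟩
  have h : Fintype.card F = (s + 1) + (Fintype.card F - (s + 1)) := by omega
  rw [baseFactor, mul_assoc, coeff_C_mul]
  conv_lhs => rw [mul_comm (X ^ _)]; enter [2, 2]; rw [h]
  rw [coeff_mul_X_pow, coeff_one_sub_pow, neg_pow a, ← mul_assoc, ← pow_add]
  simp only [Nat.add_sub_cancel]
  rw [show s + (s + 1) = 2 * s + 1 by ring, pow_succ, pow_mul]
  simp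

lemma natDegree_defect_le (hs1 : 1 < s) (hsq : s < Fintype.card F) :
    (defect s a).natDegree ≤ Fintype.card F - 1 := by
  rw [natDegree_le_iff_coeff_eq_zero]
  intro N hN
  have hp : (X ^ (Fintype.card F - 1) * (1 - C (a ^ s) * X)).natDegree ≤
      (Fintype.card F - 1) + 1 :=
    natDegree_mul_le_of_le (natDegree_X_pow_le _) (natDegree_one_sub_le _)
  rcases (show Fintype.card F ≤ N by omega).eq_or_lt with rfl | h
  · rw [defect, coeff_sub, coeff_baseFactor_card a hs1 hsq, coeff_X_pow_mul',
      if_pos (Nat.sub_le _ _), Nat.sub_sub_self (by omega)]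
    simp [coeff_one, -map_pow]
  · rw [defect, coeff_sub,
      coeff_eq_zero_of_natDegree_lt ((natDegree_baseFactor_le a hsq).trans_lt h),
      coeff_eq_zero_of_natDegree_lt (hp.trans_lt (by omega)), sub_zero]

/-- The coefficient of `X^(q-s)` in the defect is `(-1)^(s-1)`, so the defect is not constant. -/
lemma natDegree_defect_pos (hs1 : 1 < s) (hsq : s < Fintype.card F) :
    0 < (defect s a).natDegree := by
  have h : (defect s a).coeff (Fintype.card F - s) ≠ 0 := by
    have h1 : ((1 - C a * X) ^ s).coeff 0 = 1 := by simp [coeff_zero_eq_eval_zero]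
    have h2 : (X ^ (Fintype.card F - 1) * (1 - C (a ^ s) * X)).coeff (Fintype.card F - s) = 0 := by
      rw [coeff_X_pow_mul', if_neg (by omega)]
    rw [defect, coeff_sub, h2, baseFactor, mul_assoc, coeff_C_mul, coeff_X_pow_mul',
      if_pos le_rfl, Nat.sub_self, h1]
    simp
  exact lt_of_lt_of_le (by omega) (le_natDegree_of_ne_zero h)

lemma natDegree_partialSum_le (hsq : s < Fintype.card F) (k : ℕ) :
    (partialSum s a k).natDegree ≤ repunit (Fintype.card F) k - 1 := by
  induction k with
  | zero => simp [partialSum]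
  | succ k ih =>
    have h1 : (1 - X ^ (Fintype.card F ^ k - 1) : F[X]).natDegree ≤ Fintype.card F ^ k - 1 := by
      compute_degree
    refine (natDegree_add_le_of_degree_le
      ((natDegree_mul_le_of_le ih h1).trans ?_)
      ((natDegree_baseFactor_pow_le a hsq k).trans ?_))
    · rw [repunit_succ]; omega
    · rw [repunit_succ']; omega

lemma coeff_partialSum_eq_zero (hsq : s < Fintype.card F) {k N : ℕ}
    (hN : repunit (Fintype.card F) k ≤ N) : (partialSum s a k).coeff N = 0 := by
  rcases Nat.eq_zero_or_pos k with rfl | hk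
  · simp [partialSum]
  · refine coeff_eq_zero_of_natDegree_lt ((natDegree_partialSum_le a hsq k).trans_lt ?_)
    have := le_repunit (q := Fintype.card F) (by omega) k
    omega

/-- Multiplying by the Frobenius twist `X ↦ X^(q^k)` of `baseFactor`, only its leading term
reaches the degrees `q^(k+1) + r` with `q^k ≤ r`. -/
lemma coeff_baseFactor_pow_succ (hs1 : 1 < s) (hsq : s < Fintype.card F) {k r : ℕ}
    (hr : Fintype.card F ^ k ≤ r) :
    (baseFactor s a ^ repunit (Fintype.card F) (k + 1)).coeff (Fintype.card F ^ (k + 1) + r) =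
      -a ^ s * (baseFactor s a ^ repunit (Fintype.card F) k).coeff r := by
  set q := Fintype.card F with hq
  set R : F[X] := X ^ (q - 1) + defect s a with hR
  have hRdeg : R.natDegree ≤ q - 1 :=
    natDegree_add_le_of_degree_le (natDegree_X_pow_le _) (natDegree_defect_le a hs1 hsq)
  have hG : baseFactor s a = C (-a ^ s) * X ^ q + R := by
    have hX : (X : F[X]) ^ q = X ^ (q - 1) * X := by rw [← pow_succ]; congr 1; omega
    rw [baseFactor_eq, hR, hX, map_neg, ← hq]; ring
  have hzero : (baseFactor s a ^ repunit q k * expand F (q ^ k) R).coeff (q ^ (k + 1) + r) = 0 := by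
    have h1 : (baseFactor s a ^ repunit q k).natDegree ≤ q * repunit q k :=
      natDegree_baseFactor_pow_le a hsq k
    have h2 : (expand F (q ^ k) R).natDegree ≤ (q - 1) * q ^ k := by
      rw [natDegree_expand]; exact Nat.mul_le_mul_right _ hRdeg
    refine coeff_eq_zero_of_natDegree_lt
      ((natDegree_mul_le_of_le h1 h2).trans_lt ?_)
    have h3 := repunit_succ' q k
    have h4 := repunit_succ q k
    have h5 : (q - 1) * q ^ k + q ^ k = q ^ (k + 1) := by
      rw [← Nat.succ_mul, pow_succ']; congr 1; omega
    have h6 := le_repunit (q := q) (by omega) k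
    have h7 : 2 * repunit q k < q ^ k := two_mul_repunit_lt (by omega) k
    omega
  rw [baseFactor_pow_repunit_succ, ← hq]
  conv_lhs => enter [1, 2]; rw [hG]
  rw [map_add, mul_add, coeff_add, hzero, add_zero, map_mul, expand_C, map_pow, expand_X,
    ← pow_mul, ← pow_succ, mul_left_comm, coeff_C_mul, add_comm _ r, coeff_mul_X_pow]

lemma coeff_baseFactor_pow_add (hs1 : 1 < s) (hsq : s < Fintype.card F) (j n t : ℕ) :
    (baseFactor s a ^ repunit (Fintype.card F) (n + j)).coeff
        (Fintype.card F ^ j * repunit (Fintype.card F) (n + 1) + t) =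
      (-a ^ s) ^ n * (baseFactor s a ^ repunit (Fintype.card F) j).coeff
        (Fintype.card F ^ j + t) := by
  induction n with
  | zero => simp [repunit_succ]
  | succ n ih =>
    have h1 : Fintype.card F ^ j * repunit (Fintype.card F) (n + 1 + 1) + t =
        Fintype.card F ^ (n + j + 1) +
          (Fintype.card F ^ j * repunit (Fintype.card F) (n + 1) + t) := by
      rw [repunit_succ _ (n + 1)]; ring
    have h2 : Fintype.card F ^ (n + j) ≤
        Fintype.card F ^ j * repunit (Fintype.card F) (n + 1) + t := by
      rw [repunit_succ, pow_add, mul_add, mul_comm (Fintype.card F ^ n)]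
      omega
    rw [Nat.add_right_comm n 1 j, h1, coeff_baseFactor_pow_succ a hs1 hsq h2, ih, pow_succ']
    ring

/-! ### The recurrence along the indices `[1^n 0^j]_q` -/

lemma coeff_partialSum_succ (hs1 : 1 < s) (hsq : s < Fintype.card F) (j n t : ℕ) :
    (partialSum s a (n + 1 + j)).coeff
        (Fintype.card F ^ j * repunit (Fintype.card F) (n + 1) + t) =
      -(partialSum s a (n + j)).coeff
          (Fintype.card F ^ j * repunit (Fintype.card F) n + (t + 1))
        + (-a ^ s) ^ n * (baseFactor s a ^ repunit (Fintype.card F) j).coeff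
            (Fintype.card F ^ j + t) := by
  have hpos : 0 < Fintype.card F ^ (n + j) := pow_pos Fintype.card_pos _
  have h1 : Fintype.card F ^ j * repunit (Fintype.card F) (n + 1) + t =
      (Fintype.card F ^ j * repunit (Fintype.card F) n + (t + 1)) +
        (Fintype.card F ^ (n + j) - 1) := by
    have : Fintype.card F ^ (n + j) = Fintype.card F ^ j * Fintype.card F ^ n := by
      rw [pow_add, mul_comm]
    rw [repunit_succ, mul_add, ← this]; omega
  have h2 : repunit (Fintype.card F) (n + j) ≤
      Fintype.card F ^ j * repunit (Fintype.card F) (n + 1) + t := by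
    have := two_mul_repunit_lt (q := Fintype.card F) (by omega) (n + j)
    omega
  rw [Nat.add_right_comm n 1 j, partialSum, coeff_add, coeff_baseFactor_pow_add a hs1 hsq,
    mul_sub, mul_one, coeff_sub, coeff_partialSum_eq_zero a hsq h2]
  conv_lhs => enter [1, 2]; rw [h1]
  rw [coeff_mul_X_pow, zero_sub]

lemma coeff_recurrencePoly (j t : ℕ) :
    (recurrencePoly s a j).coeff (Fintype.card F ^ j + t) =
      (baseFactor s a ^ repunit (Fintype.card F) j).coeff (Fintype.card F ^ j + t)
        - (partialSum s a j).coeff (t + 1) + a ^ s * (partialSum s a j).coeff t := by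
  have hpos : 0 < Fintype.card F ^ j := pow_pos Fintype.card_pos _
  have h : Fintype.card F ^ j + t = (t + 1) + (Fintype.card F ^ j - 1) := by omega
  have h2 : (X ^ (Fintype.card F ^ j - 1) * (1 - C (a ^ s) * X) * partialSum s a j).coeff
      (Fintype.card F ^ j + t) =
      (partialSum s a j).coeff (t + 1) - a ^ s * (partialSum s a j).coeff t := by
    rw [mul_assoc, mul_comm, h, coeff_mul_X_pow, sub_mul, one_mul, coeff_sub, mul_assoc,
      coeff_C_mul, coeff_X_mul]
  rw [recurrencePoly, coeff_sub, h2]; ring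

/-- The shift `t` in the index is what makes the induction on `n` work: by `coeff_partialSum_succ`,
passing from `n` to `n + 1` at shift `t` is, up to sign and a term annihilated by `v(n+1) + b v(n)`,
passing to shift `t + 1` at `n`. -/
lemma coeff_partialSum_recurrence (hs1 : 1 < s) (hsq : s < Fintype.card F) (j n t : ℕ) :
    (partialSum s a (n + 1 + j)).coeff
        (Fintype.card F ^ j * repunit (Fintype.card F) (n + 1) + t)
      + a ^ s * (partialSum s a (n + j)).coeff
        (Fintype.card F ^ j * repunit (Fintype.card F) n + t) =
      (-1) ^ n * (recurrencePoly s a j).coeff (Fintype.card F ^ j + (n + t)) := by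
  induction n generalizing t with
  | zero =>
    rw [coeff_partialSum_succ a hs1 hsq, zero_add, zero_add, coeff_recurrencePoly]
    simp; ring
  | succ n ih =>
    have := ih (t + 1)
    rw [coeff_partialSum_succ a hs1 hsq j (n + 1), coeff_partialSum_succ a hs1 hsq j n t]
    rw [show n + 1 + t = n + (t + 1) by ring]
    linear_combination -this

/-! ### Degrees of the recurrence polynomials -/

variable (s)

/-- Writing `baseFactor` as `X^(q-1) (1-a^s X)` plus the defect, the multiples of `partialSum s a j`
from the binomial cancel. -/
lemma recurrencePoly_succ (j : ℕ) :
    recurrencePoly s a (j + 1) =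
      recurrencePoly s a j * X ^ (Fintype.card F ^ j * (Fintype.card F - 1))
          * (1 - X ^ (Fintype.card F ^ j - 1))
        + baseFactor s a ^ repunit (Fintype.card F) j
          * expand F (Fintype.card F ^ j) (defect s a) := by
  have hpos : 0 < Fintype.card F ^ j := pow_pos Fintype.card_pos _
  have hq : 0 < Fintype.card F := Fintype.card_pos
  have h1 : (X : F[X]) ^ Fintype.card F ^ j = X ^ (Fintype.card F ^ j - 1) * X := by
    rw [← pow_succ]; congr 1; omega
  have h2 : (X : F[X]) ^ (Fintype.card F ^ (j + 1) - 1) =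
      X ^ (Fintype.card F ^ j * (Fintype.card F - 1)) * X ^ (Fintype.card F ^ j - 1) := by
    rw [← pow_add, Nat.mul_sub, mul_one, pow_succ]
    have := Nat.le_mul_of_pos_right (Fintype.card F ^ j) hq
    congr 1; omega
  have h3 : expand F (Fintype.card F ^ j) (baseFactor s a) =
      X ^ (Fintype.card F ^ j * (Fintype.card F - 1))
          * (1 - C (a ^ s) * (X ^ (Fintype.card F ^ j - 1) * X))
        + expand F (Fintype.card F ^ j) (defect s a) := by
    conv_lhs => rw [baseFactor_eq]
    simp only [map_add, map_mul, map_sub, map_pow, expand_X, expand_C, map_one]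
    rw [← pow_mul, h1]
  rw [recurrencePoly, recurrencePoly, partialSum, baseFactor_pow_repunit_succ, h3, h2]
  ring

lemma recurrencePoly_one : recurrencePoly s a 1 = defect s a := by
  simp [recurrencePoly, partialSum, repunit, defect]

variable {s}

/-- In `recurrencePoly_succ` the term without the defect dominates as soon as its degree exceeds
the obvious bound for the other one. -/
lemma natDegree_recurrencePoly_succ (hsq : s < Fintype.card F) {j : ℕ} (hj : 1 ≤ j)
    (h0 : recurrencePoly s a j ≠ 0)
    (hlt : Fintype.card F * repunit (Fintype.card F) j
      + (defect s a).natDegree * Fintype.card F ^ j <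
        (recurrencePoly s a j).natDegree + (Fintype.card F ^ (j + 1) - 1)) :
    (recurrencePoly s a (j + 1)).natDegree =
      (recurrencePoly s a j).natDegree + (Fintype.card F ^ (j + 1) - 1) := by
  have hq1 : 1 < Fintype.card F := Fintype.one_lt_card
  have hqj : 1 < Fintype.card F ^ j := Nat.one_lt_pow (by omega) hq1
  have hdeg : (1 - X ^ (Fintype.card F ^ j - 1) : F[X]).natDegree = Fintype.card F ^ j - 1 := by
    rw [natDegree_sub_eq_right_of_natDegree_lt] <;> simp; omega
  have hne : (1 - X ^ (Fintype.card F ^ j - 1) : F[X]) ≠ 0 := by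
    intro h; rw [h, natDegree_zero] at hdeg; omega
  have hmain : (recurrencePoly s a j * X ^ (Fintype.card F ^ j * (Fintype.card F - 1))
      * (1 - X ^ (Fintype.card F ^ j - 1))).natDegree =
      (recurrencePoly s a j).natDegree + (Fintype.card F ^ (j + 1) - 1) := by
    rw [natDegree_mul (mul_ne_zero h0 (pow_ne_zero _ X_ne_zero)) hne,
      natDegree_mul h0 (pow_ne_zero _ X_ne_zero), natDegree_X_pow, hdeg, Nat.mul_sub, mul_one,
      pow_succ]
    have := Nat.le_mul_of_pos_right (Fintype.card F ^ j) (show 0 < Fintype.card F by omega)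
    omega
  rw [recurrencePoly_succ, natDegree_add_eq_left_of_natDegree_lt, hmain]
  rw [hmain]
  refine lt_of_le_of_lt (natDegree_mul_le_of_le (natDegree_baseFactor_pow_le a hsq j)
    (natDegree_expand _ _).le) hlt

/-- The recursion starts from the defect itself, of degree `d` with `1 ≤ d ≤ q - 1`; the domination
amounts to `q + d q < d + q^2 - 1`, which needs `q ≥ 3`. -/
lemma natDegree_recurrencePoly_two (hs1 : 1 < s) (hsq : s < Fintype.card F) :
    (recurrencePoly s a 2).natDegree =
      (defect s a).natDegree + (Fintype.card F ^ 2 - 1) := by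
  have hd0 := natDegree_defect_pos a hs1 hsq
  have hd1 := natDegree_defect_le a hs1 hsq
  have h := natDegree_recurrencePoly_succ a hsq le_rfl (j := 1)
  rw [recurrencePoly_one] at h
  refine h (ne_zero_of_natDegree_gt hd0) ?_
  obtain ⟨r, hr⟩ : ∃ r, Fintype.card F = r + 3 := ⟨Fintype.card F - 3, by omega⟩
  rw [hr] at hd1 ⊢
  have : (r + 3) ^ (1 + 1) - 1 = r ^ 2 + 6 * r + 8 := by
    rw [show (r + 3) ^ (1 + 1) = r ^ 2 + 6 * r + 8 + 1 by ring]; rfl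
  rw [this]
  have hd2 : (defect s a).natDegree ≤ r + 2 := by omega
  simp only [repunit, Finset.sum_range_one, pow_zero, pow_one]
  nlinarith

lemma pow_le_natDegree_recurrencePoly (hs1 : 1 < s) (hsq : s < Fintype.card F) {j : ℕ}
    (hj : 2 ≤ j) :
    Fintype.card F ^ j ≤ (recurrencePoly s a j).natDegree ∧
      (recurrencePoly s a (j + 1)).natDegree =
        (recurrencePoly s a j).natDegree + (Fintype.card F ^ (j + 1) - 1) := by
  have key : ∀ j, 2 ≤ j → Fintype.card F ^ j ≤ (recurrencePoly s a j).natDegree →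
      (recurrencePoly s a (j + 1)).natDegree =
        (recurrencePoly s a j).natDegree + (Fintype.card F ^ (j + 1) - 1) := by
    intro j hj h
    have hpos : 0 < Fintype.card F ^ j := pow_pos Fintype.card_pos _
    refine natDegree_recurrencePoly_succ a hsq (by omega)
      (ne_zero_of_natDegree_gt (lt_of_lt_of_le hpos h)) ?_
    have h1 : (defect s a).natDegree * Fintype.card F ^ j ≤
        (Fintype.card F - 1) * Fintype.card F ^ j :=
      Nat.mul_le_mul_right _ (natDegree_defect_le a hs1 hsq)
    have h2 : (Fintype.card F - 1) * Fintype.card F ^ j + Fintype.card F ^ j =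
        Fintype.card F ^ (j + 1) := by
      rw [← Nat.succ_mul, pow_succ']; congr 1; omega
    have h3 := repunit_succ' (Fintype.card F) j
    have h4 := repunit_succ (Fintype.card F) j
    have h5 := two_mul_repunit_lt (q := Fintype.card F) (by omega) j
    have h6 := le_repunit (q := Fintype.card F) (by omega) j
    omega
  have h : Fintype.card F ^ j ≤ (recurrencePoly s a j).natDegree := by
    induction j, hj using Nat.le_induction with
    | base =>
      have := natDegree_defect_pos a hs1 hsq
      rw [natDegree_recurrencePoly_two a hs1 hsq]; omega
    | succ j hj ih =>
      have hpos : 0 < Fintype.card F ^ j := pow_pos Fintype.card_pos _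
      rw [key j hj ih]; omega
  exact ⟨h, key j hj h⟩

end Polynomials

/-! ### Periodicity of solutions of a first-order recurrence -/

section Periodicity

lemma PeriodicFrom.apply_add_mul {A : Type*} {v : ℕ → A} {N : ℕ} (h : PeriodicFrom v N) :
    ∃ p : ℕ, 0 < p ∧ ∀ n, N ≤ n → ∀ k, v (n + k * p) = v n := by
  obtain ⟨p, hp, hv⟩ := h
  refine ⟨p, hp, fun n hn k => ?_⟩
  induction k with
  | zero => simp
  | succ k ih => rw [Nat.succ_mul, ← add_assoc, hv _ (by omega), ih]

/-- A periodic tail that vanishes eventually vanishes throughout. -/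
lemma PeriodicFrom.eq_zero {A : Type*} [Zero A] {v : ℕ → A} {N M : ℕ} (h : PeriodicFrom v N)
    (hM : ∀ n, M ≤ n → v n = 0) {n : ℕ} (hn : N ≤ n) : v n = 0 := by
  obtain ⟨p, hp, hv⟩ := h.apply_add_mul
  rw [← hv n hn M]
  exact hM _ (le_add_left (Nat.le_mul_of_pos_right M hp))

variable {F : Type*} [Field F] {b : F} {v D : ℕ → F}

/-- For `b = 0` the term `v N` itself is not constrained, hence the extra step. -/
lemma periodicFrom_of_recurrence [Fintype F] [Decidable (b = 0)]
    (hv : ∀ n, v (n + 1) + b * v n = D n) {N : ℕ}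
    (hD : ∀ n, N ≤ n → D n = 0) : PeriodicFrom v (N + if b = 0 then 1 else 0) := by
  split_ifs with hb
  · have h0 : ∀ n, N + 1 ≤ n → v n = 0 := by
      intro n hn
      obtain ⟨m, rfl⟩ : ∃ m, n = m + 1 := ⟨n - 1, by omega⟩
      simpa [hb, hD m (by omega)] using hv m
    exact ⟨1, one_pos, fun n hn => by rw [h0 n hn, h0 _ (by omega)]⟩
  · have hq : 1 < Fintype.card F := Fintype.one_lt_card
    have hpow : ∀ n, N ≤ n → ∀ k, v (n + k) = (-b) ^ k * v n := by
      intro n hn k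
      induction k with
      | zero => simp
      | succ k ih =>
        have := hv (n + k)
        rw [hD _ (by omega), ih] at this
        rw [← add_assoc, pow_succ]; linear_combination this
    refine ⟨Fintype.card F - 1, by omega, fun n hn => ?_⟩
    rw [add_zero] at hn
    rw [hpow n hn, FiniteField.pow_card_sub_one_eq_one _ (neg_ne_zero.mpr hb), one_mul]

lemma preperiod_le {A : Type*} {v : ℕ → A} {N : ℕ} (h : PeriodicFrom v N) : preperiod v ≤ N :=
  Nat.sInf_le h

lemma preperiod_of_recurrence [Fintype F] [Decidable (b = 0)]
    (hv : ∀ n, v (n + 1) + b * v n = D n) {N : ℕ}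
    (hN : D N ≠ 0) (hD : ∀ n, N < n → D n = 0) :
    preperiod v = N + 1 + if b = 0 then 1 else 0 := by
  have hper := periodicFrom_of_recurrence hv (N := N + 1) hD
  refine le_antisymm (preperiod_le hper) (le_csInf ⟨_, hper⟩ fun M hM => ?_)
  by_contra hlt
  refine hN ?_
  split_ifs at hlt with hb
  · have h0 : ∀ n, N + 2 ≤ n → v n = 0 := by
      intro n hn
      obtain ⟨m, rfl⟩ : ∃ m, n = m + 1 := ⟨n - 1, by omega⟩
      simpa [hb, hD m (by omega)] using hv m
    rw [← hv N, hb, PeriodicFrom.eq_zero hM h0 (by omega)]; simp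
  · have hDM : PeriodicFrom D M := by
      obtain ⟨p, hp, hM⟩ := hM
      refine ⟨p, hp, fun n hn => ?_⟩
      rw [← hv, ← hv, hM n hn, show n + p + 1 = n + 1 + p by ring, hM _ (by omega)]
    exact hDM.eq_zero (M := N + 1) hD (by omega)

end Periodicity

/-! ### Coefficients of the series -/

section Series

variable {F : Type*} [Field F]

lemma coeff_mul_of_X_pow_dvd_sub_one {p t : PowerSeries F} {M N : ℕ}
    (ht : PowerSeries.X ^ M ∣ t - 1) (hN : N < M) :
    PowerSeries.coeff N (p * t) = PowerSeries.coeff N p := by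
  have h : p * t = p + p * (t - 1) := by ring
  rw [h, map_add, PowerSeries.X_pow_dvd_iff.mp (ht.mul_left p) N hN, add_zero]

variable [Fintype F]

lemma tailProd_eq_mul (k : ℕ) :
    tailProd F k = (1 - PowerSeries.X ^ (Fintype.card F ^ (k + 1) - 1)) * tailProd F (k + 1) := by
  let _ : TopologicalSpace F := ⊥
  have _ : DiscreteTopology F := ⟨rfl⟩
  set f : ℕ → PowerSeries F := fun i => 1 - PowerSeries.X ^ (Fintype.card F ^ (k + 1 + i) - 1)
    with hf
  have h : (fun i => f (i + 1)) =
      fun i => 1 - PowerSeries.X ^ (Fintype.card F ^ (k + 1 + 1 + i) - 1) := by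
    funext i
    simp only [hf]
    rw [← add_assoc, Nat.add_right_comm]
  have hm : Multipliable fun i => f (i + 1) := by
    rw [h]; exact multipliable_tailProd F (k + 1)
  have h0 : f 0 = 1 - PowerSeries.X ^ (Fintype.card F ^ (k + 1) - 1) := rfl
  have hk : tailProd F k = ∏' i, f i := rfl
  have hk' : tailProd F (k + 1) = ∏' i, f (i + 1) := by rw [h]; rfl
  rw [hk, hk', tprod_eq_zero_mul' hm, h0]

lemma X_pow_dvd_tailProd_sub_one (k : ℕ) :
    (PowerSeries.X : PowerSeries F) ^ (Fintype.card F ^ (k + 1) - 1) ∣ tailProd F k - 1 := by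
  let _ : TopologicalSpace F := ⊥
  have _ : DiscreteTopology F := ⟨rfl⟩
  rw [PowerSeries.X_pow_dvd_iff]
  intro m hm
  rw [map_sub, sub_eq_zero]
  have hS : ∀ S : Finset ℕ, PowerSeries.X ^ (Fintype.card F ^ (k + 1) - 1) ∣
      ∏ i ∈ S, (1 - (PowerSeries.X : PowerSeries F) ^ (Fintype.card F ^ (k + 1 + i) - 1)) - 1 := by
    intro S
    refine Finset.prod_induction _ (fun p : PowerSeries F =>
      PowerSeries.X ^ (Fintype.card F ^ (k + 1) - 1) ∣ p - 1) (fun p r hp hr => ?_) (by simp)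
      fun i _ => ?_
    · rw [show p * r - 1 = p * (r - 1) + (p - 1) by ring]
      exact (hr.mul_left p).add hp
    · rw [sub_sub_cancel_left, dvd_neg]
      exact pow_dvd_pow _
        (Nat.sub_le_sub_right (Nat.pow_le_pow_right Fintype.card_pos (Nat.le_add_right _ _)) _)
  refine tendsto_nhds_unique (((PowerSeries.WithPiTopology.continuous_coeff F m).tendsto _).comp
    (multipliable_tailProd F k).hasProd) (tendsto_const_nhds.congr fun S => ?_)
  have := PowerSeries.X_pow_dvd_iff.mp (hS S) m hm
  rw [map_sub, sub_eq_zero] at this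
  exact this.symm

lemma summand_eq (s : ℕ) (a : F) (k : ℕ) :
    summand s a k =
      (baseFactor s a ^ repunit (Fintype.card F) k : F[X]) * tailProd F k := by
  have hε : ((-1 : F) ^ (s - 1)) ^ repunit (Fintype.card F) k = (-1) ^ (k * (s - 1)) := by
    induction k with
    | zero => simp
    | succ k ih => rw [repunit_succ, pow_add, ih, FiniteField.pow_card_pow, ← pow_add]; ring
  rw [summand, ← Nat.geomSum_eq Fintype.one_lt_card, baseFactor, mul_pow, mul_pow, ← C_pow, hε]
  simp [repunit, pow_mul]

lemma sum_summand_eq (s : ℕ) (a : F) (k : ℕ) :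
    ∑ i ∈ Finset.range (k + 1), summand s a i =
      (partialSum s a (k + 1) : PowerSeries F) * tailProd F k := by
  induction k with
  | zero => simp [summand_eq, partialSum]
  | succ k ih =>
    rw [Finset.sum_range_succ, ih, summand_eq, tailProd_eq_mul, partialSum.eq_2 s a (k + 1)]
    push_cast
    ring

lemma X_pow_dvd_summand {s : ℕ} (hsq : s < Fintype.card F) (a : F) (k : ℕ) :
    (PowerSeries.X : PowerSeries F) ^ repunit (Fintype.card F) k ∣ summand s a k := by
  rw [summand, ← Nat.geomSum_eq Fintype.one_lt_card]
  refine Dvd.dvd.mul_right (Dvd.dvd.mul_right (Dvd.dvd.mul_left (pow_dvd_pow _ ?_) _) _) _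
  exact Nat.le_mul_of_pos_left _ (by omega)

lemma repunit_mono {q : ℕ} : Monotone (repunit q) :=
  monotone_nat_of_le_succ fun k => by rw [repunit_succ]; omega

lemma uCoeff_eq {s : ℕ} (hs1 : 1 < s) (hsq : s < Fintype.card F) (a : F) {k N : ℕ}
    (hN : N < repunit (Fintype.card F) k) : uCoeff s a N = (partialSum s a k).coeff N := by
  let _ : TopologicalSpace F := ⊥
  have _ : DiscreteTopology F := ⟨rfl⟩
  obtain ⟨k, rfl⟩ : ∃ m, k = m + 1 :=
    Nat.exists_eq_succ_of_ne_zero (by rintro rfl; simp at hN)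
  have hzero : ∀ i ∉ Finset.range (k + 1), PowerSeries.coeff N (summand s a i) = 0 := by
    intro i hi
    refine PowerSeries.X_pow_dvd_iff.mp (X_pow_dvd_summand hsq a i) N (hN.trans_le ?_)
    exact repunit_mono (by simpa using hi)
  have hlt : N < Fintype.card F ^ (k + 1) - 1 := by
    have := two_mul_repunit_lt (q := Fintype.card F) (by omega) (k + 1)
    omega
  rw [uCoeff, alphaPiL, (summable_summand s hsq a).map_tsum _
    (PowerSeries.WithPiTopology.continuous_coeff F N), tsum_eq_sum hzero, ← map_sum,
    sum_summand_eq, coeff_mul_of_X_pow_dvd_sub_one (X_pow_dvd_tailProd_sub_one k) hlt,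
    Polynomial.coeff_coe]

/-! ### The sequences `uSeq s a j` -/

lemma uSeq_eq {s : ℕ} (hs1 : 1 < s) (hsq : s < Fintype.card F) (a : F) {j : ℕ} (hj : 1 ≤ j)
    (n : ℕ) : uSeq s a j n =
      (partialSum s a (n + j)).coeff (Fintype.card F ^ j * repunit (Fintype.card F) n + 0) := by
  rw [uSeq, onesZeros_eq, add_zero]
  refine uCoeff_eq hs1 hsq a ?_
  have := le_repunit (q := Fintype.card F) (by omega) j
  rw [repunit_add]; omega

lemma uSeq_recurrence {s : ℕ} (hs1 : 1 < s) (hsq : s < Fintype.card F) (a : F) {j : ℕ}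
    (hj : 1 ≤ j) (n : ℕ) :
    uSeq s a j (n + 1) + a ^ s * uSeq s a j n =
      (-1) ^ n * (recurrencePoly s a j).coeff (Fintype.card F ^ j + n) := by
  rw [uSeq_eq hs1 hsq a hj, uSeq_eq hs1 hsq a hj, coeff_partialSum_recurrence a hs1 hsq, add_zero]

/-- The excluded case `n = 0` has index `0`, where the truncated product
`1 - X^(q^n - 1)` degenerates to `0`. -/
lemma uSeq_zero_apply {s : ℕ} (hs1 : 1 < s) (hsq : s < Fintype.card F) (a : F) {n : ℕ}
    (hn : 1 ≤ n) :
    uSeq s a 0 n =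
      (baseFactor s a ^ repunit (Fintype.card F) n).coeff (repunit (Fintype.card F) n) := by
  have hlt : repunit (Fintype.card F) n < Fintype.card F ^ n - 1 := by
    have := two_mul_repunit_lt (q := Fintype.card F) (by omega) n
    have := le_repunit (q := Fintype.card F) (by omega) n
    omega
  have hpos : 0 < Fintype.card F ^ n := pow_pos Fintype.card_pos _
  rw [uSeq, onesZeros_eq, pow_zero, one_mul, uCoeff_eq hs1 hsq a (k := n + 1)
    (by rw [repunit_succ]; omega), partialSum, coeff_add, mul_sub, mul_one, coeff_sub,
    coeff_partialSum_eq_zero a hsq le_rfl, coeff_mul_X_pow', if_neg (by omega)]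
  simp

lemma coeff_baseFactor_pow_self {s : ℕ} (hsq : s < Fintype.card F) (a : F) (m : ℕ) :
    (baseFactor s a ^ m).coeff m = (baseFactor s a).coeff 1 ^ m := by
  obtain ⟨p, hp⟩ : (X : F[X]) ∣ baseFactor s a := by
    have h : (X : F[X]) ∣ X ^ (Fintype.card F - s) := dvd_pow_self _ (by omega)
    exact Dvd.dvd.mul_right (Dvd.dvd.mul_left h _) _
  rw [hp, mul_pow, coeff_X_pow_mul', if_pos le_rfl, Nat.sub_self, coeff_X_mul]
  simp [coeff_zero_eq_eval_zero]

lemma ultimatelyPeriodic_uSeq_zero {s : ℕ} (hs1 : 1 < s) (hsq : s < Fintype.card F) (a : F) :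
    UltimatelyPeriodic (uSeq s a 0) := by
  refine ⟨1, Fintype.card F - 1, by omega, fun n hn => ?_⟩
  have key : ∀ n, 1 ≤ n → uSeq s a 0 n = (baseFactor s a).coeff 1 ^ n := by
    intro n hn
    rw [uSeq_zero_apply hs1 hsq a hn, coeff_baseFactor_pow_self hsq]
    clear hn
    induction n with
    | zero => simp
    | succ n ih => rw [repunit_succ, pow_add, ih, FiniteField.pow_card_pow, pow_succ]
  rw [key n hn, key _ (by omega), pow_add]
  by_cases hc : (baseFactor s a).coeff 1 = 0
  · rw [hc, zero_pow (by omega), zero_mul]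
  · rw [FiniteField.pow_card_sub_one_eq_one _ hc, mul_one]

variable [DecidableEq F]

lemma periodicFrom_uSeq {s : ℕ} (hs1 : 1 < s) (hsq : s < Fintype.card F) (a : F) {j : ℕ}
    (hj : 1 ≤ j) {N : ℕ} (hN : (recurrencePoly s a j).natDegree < Fintype.card F ^ j + N) :
    PeriodicFrom (uSeq s a j) (N + if a ^ s = 0 then 1 else 0) := by
  refine periodicFrom_of_recurrence (uSeq_recurrence hs1 hsq a hj) fun n hn => ?_
  rw [coeff_eq_zero_of_natDegree_lt (by omega), mul_zero]

lemma preperiod_uSeq {s : ℕ} (hs1 : 1 < s) (hsq : s < Fintype.card F) (a : F) {j : ℕ}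
    (hj : 2 ≤ j) :
    preperiod (uSeq s a j) = (recurrencePoly s a j).natDegree - Fintype.card F ^ j + 1
      + if a ^ s = 0 then 1 else 0 := by
  obtain ⟨hle, -⟩ := pow_le_natDegree_recurrencePoly a hs1 hsq hj
  have hpos : 0 < Fintype.card F ^ j := pow_pos Fintype.card_pos _
  refine preperiod_of_recurrence (uSeq_recurrence hs1 hsq a (by omega)) ?_ fun n hn => ?_
  · rw [Nat.add_sub_cancel' hle]
    refine mul_ne_zero (pow_ne_zero _ (neg_ne_zero.mpr one_ne_zero)) ?_
    rw [coeff_natDegree, leadingCoeff_ne_zero]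
    exact ne_zero_of_natDegree_gt (lt_of_lt_of_le hpos hle)
  · rw [coeff_eq_zero_of_natDegree_lt (by omega), mul_zero]

lemma preperiod_uSeq_succ {s : ℕ} (hs1 : 1 < s) (hsq : s < Fintype.card F) (a : F) {j : ℕ}
    (hj : 2 ≤ j) :
    preperiod (uSeq s a (j + 1)) = preperiod (uSeq s a j) + (Fintype.card F ^ j - 1) := by
  obtain ⟨hle, hdeg⟩ := pow_le_natDegree_recurrencePoly a hs1 hsq hj
  have hpos : 0 < Fintype.card F ^ j := pow_pos Fintype.card_pos _
  have hpos' : 0 < Fintype.card F ^ (j + 1) := pow_pos Fintype.card_pos _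
  rw [preperiod_uSeq hs1 hsq a hj, preperiod_uSeq hs1 hsq a (by omega), hdeg]
  omega

lemma preperiod_uSeq_one_le {s : ℕ} (hs1 : 1 < s) (hsq : s < Fintype.card F) (a : F) :
    preperiod (uSeq s a 1) ≤ if a ^ s = 0 then 1 else 0 := by
  have h : (recurrencePoly s a 1).natDegree < Fintype.card F ^ 1 + 0 := by
    have := natDegree_defect_le a hs1 hsq
    rw [recurrencePoly_one]; simp only [pow_one]; omega
  simpa using preperiod_le (periodicFrom_uSeq hs1 hsq a le_rfl h)

lemma preperiod_uSeq_lt_succ {s : ℕ} (hs1 : 1 < s) (hsq : s < Fintype.card F) (a : F) {j : ℕ}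
    (hj : 1 ≤ j) : preperiod (uSeq s a j) < preperiod (uSeq s a (j + 1)) := by
  rcases hj.eq_or_lt with rfl | hj
  · have := preperiod_uSeq_one_le hs1 hsq a
    rw [preperiod_uSeq hs1 hsq a le_rfl]; omega
  · have : 1 < Fintype.card F ^ j := Nat.one_lt_pow (by omega) (by omega)
    rw [preperiod_uSeq_succ hs1 hsq a hj]; omega

end Series

theorem proposition1 {F : Type*} [Field F] [Fintype F] (a : F) (s : ℕ)
    (hs1 : 1 < s) (hsq : s < Fintype.card F) :
    (∀ j : ℕ, UltimatelyPeriodic (uSeq s a j)) ∧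
    (∀ i j : ℕ, 1 ≤ i → i < j → preperiod (uSeq s a i) < preperiod (uSeq s a j)) ∧
    (∀ j : ℕ, 3 ≤ j → Fintype.card F ^ (j - 1) ≤ preperiod (uSeq s a j)) ∧
    (Set.range fun j : ℕ => uSeq s a j).Infinite := by
  classical
  have hmono : StrictMono fun j => preperiod (uSeq s a (j + 1)) :=
    strictMono_nat_of_lt_succ fun j => preperiod_uSeq_lt_succ hs1 hsq a (by omega)
  refine ⟨fun j => ?_, fun i j hi hij => ?_, fun j hj => ?_, ?_⟩
  · rcases Nat.eq_zero_or_pos j with rfl | hj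
    · exact ultimatelyPeriodic_uSeq_zero hs1 hsq a
    · exact ⟨_, periodicFrom_uSeq hs1 hsq a hj
        (N := (recurrencePoly s a j).natDegree + 1) (by omega)⟩
  · obtain ⟨i, rfl⟩ : ∃ m, i = m + 1 := ⟨i - 1, by omega⟩
    obtain ⟨j, rfl⟩ : ∃ m, j = m + 1 := ⟨j - 1, by omega⟩
    exact hmono (by omega)
  · obtain ⟨j, rfl⟩ : ∃ m, j = m + 1 := ⟨j - 1, by omega⟩
    have hpos : 0 < preperiod (uSeq s a j) := by
      rw [preperiod_uSeq hs1 hsq a (by omega)]; omega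
    rw [preperiod_uSeq_succ hs1 hsq a (by omega), Nat.add_sub_cancel]
    omega
  · refine Set.infinite_of_injective_forall_mem (f := fun j : ℕ => uSeq s a (j + 1)) ?_
      fun j => ⟨j + 1, rfl⟩
    exact fun i j hij => hmono.injective (congrArg preperiod hij)
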